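/- For an integer $N\ge 1$ and a real number $\xi$, let $\lambda_N(\xi)\in\mathbb{R}\cup\{+\infty\}$ be the supremum of all real $\lambda$ such that the system $$1\le |x|\le X,\qquad \max_{1\le j\le N}|\xi^{j}x-y_j|\le X^{-\lambda}$$ has a solution $(x,y_1,\dots,y_N)\in\mathbb{Z}^{N+1}$ for arbitrarily large real $X$, and let $\widehat{w}_N(\xi)$ be the supremum of all real $w$ such that the system $$\max_{1\le j\le N}|x_j|\le X,\qquad |x_0+\xi x_1+\cdots+\xi^{N}x_N|\le X^{-w}$$ has a solution $(x_0,\dots,x_N)\in\mathbb{Z}^{N+1}\setminus\{0\}$ for all sufficiently large real $X$. Let $B:[1,2]\to\mathbb{R}$ be given by $$B(W)=\frac{\left(2-\sqrt{2-W}\right)\left(W+2\sqrt{2-W}-2\right)}{W\sqrt{2-W}}\quad(1\le W<2),\qquad B(2)=\lim_{W\to 2^-}B(W)=2.$$ Let $\xi$ be a transcendental real number. Put $$\overline{W}=\limsup_{n\to\infty}\frac{\widehat{w}_n(\xi)}{n},\quad \overline{\Lambda}=\limsup_{n\to\infty} n\lambda_n(\xi),\quad \underline{W}=\liminf_{n\to\infty}\frac{\widehat{w}_n(\xi)}{n},\quad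 \underline{\Lambda}=\liminf_{n\to\infty} n\lambda_n(\xi),$$ where $\overline{\Lambda},\underline{\Lambda}$ may be $+\infty$. Then $\overline{W},\underline{W}\in[1,2]$, and $$\overline{\Lambda}\ge B(\overline{W}),\qquad \underline{\Lambda}\ge B(\underline{W}).$$ -/

import Mathlib

open Filter Topology

noncomputable section

/-- The system `1 ≤ |x| ≤ X`, `max_j |ξ_j x - y_j| ≤ X ^ (-l)` has an integer solution
`(x, y_1, …, y_N)`. -/
def SimultaneousSolvable {N : ℕ} (ξ : Fin N → ℝ) (l X : ℝ) : Prop :=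
  ∃ (x : ℤ) (y : Fin N → ℤ), 1 ≤ |(x : ℝ)| ∧ |(x : ℝ)| ≤ X ∧
    ∀ j, |ξ j * (x : ℝ) - (y j : ℝ)| ≤ X ^ (-l)

/-- The system `max_{1 ≤ j ≤ N} |x_j| ≤ X`, `|x_0 + ξ_1 x_1 + ⋯ + ξ_N x_N| ≤ X ^ (-w)` has a
nonzero integer solution `(x_0, x_1, …, x_N)`; here `a = x_0` and `x = (x_1, …, x_N)`. -/
def LinearFormSolvable {N : ℕ} (ξ : Fin N → ℝ) (w X : ℝ) : Prop :=
  ∃ (a : ℤ) (x : Fin N → ℤ), ¬(a = 0 ∧ x = 0) ∧ (∀ j, |(x j : ℝ)| ≤ X) ∧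
    |(a : ℝ) + ∑ j, ξ j * (x j : ℝ)| ≤ X ^ (-w)

/-- The ordinary exponent of simultaneous approximation of a real vector: the supremum, possibly
infinite, of the real `l` such that the system is solvable for arbitrarily large `X`. -/
def ordinarySimultaneousExponent {N : ℕ} (ξ : Fin N → ℝ) : EReal :=
  sSup {e : EReal | ∃ l : ℝ, e = (l : EReal) ∧ ∃ᶠ X : ℝ in atTop, SimultaneousSolvable ξ l X}

/-- The uniform exponent of linear form approximation of a real vector: the supremum of the
real `w` such that the system is solvable for all sufficiently large `X`. -/
def uniformLinearFormExponent {N : ℕ} (ξ : Fin N → ℝ) : EReal :=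
  sSup {e : EReal | ∃ w : ℝ, e = (w : EReal) ∧ ∀ᶠ X : ℝ in atTop, LinearFormSolvable ξ w X}

/-- The point `(ξ, ξ², …, ξ^N)` on the Veronese curve. -/
def veronesePoint (N : ℕ) (ξ : ℝ) : Fin N → ℝ := fun j => ξ ^ ((j : ℕ) + 1)

/-- The exponent `λ_N(ξ)`. -/
def lambdaExponent (N : ℕ) (ξ : ℝ) : EReal := ordinarySimultaneousExponent (veronesePoint N ξ)

/-- The exponent `ŵ_N(ξ)`. -/
def wHatExponent (N : ℕ) (ξ : ℝ) : EReal := uniformLinearFormExponent (veronesePoint N ξ)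

/-- The lower bound as a function of `W ∈ [1, 2]`. At `W = 2`, where the quotient reads `0 / 0`,
it takes the value `2`, the left-sided limit of the quotient. -/
def asymptoticBound (W : ℝ) : ℝ :=
  if W = 2 then 2
  else ((2 - √(2 - W)) * (W + 2 * √(2 - W) - 2)) / (W * √(2 - W))

end

/-! Fix `n` and `w < ŵ_n(ξ)`. Multiplicativity of the Mahler measure yields, for arbitrarily large
`H`, an irreducible `P` and some `Q` not divisible by `P`, of degree at most `n` and height at most
`H`, both of size at most `H ^ (-w')` at `ξ`, with `w'` slightly below `w`
(`exists_irreducible_and_not_dvd`).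

For `n ≤ N < w`, take `k = N + 1 - n` shifts of each. A resultant-type estimate gives `k < deg P`
for large `H`, so these `2k` integer vectors in dimension `N + 1` are independent. The integer
vectors `z` orthogonal to all of them form a lattice of rank `r = 2n - N - 1`, which contains a
short point by `exists_int_orthogonal_abs_mulVec_le`. Up to small losses, `z` satisfies `|z_0| ≤ H ^
(w - e)` and `|ξ ^ j z_0 - z_j| ≤ H ^ (-1 - e)` with `e = (w - N) / r`. Hence `λ_N ≥ (1 + e) / (w -
e)`.

For `w = W n` and `N ∼ t n`, the resulting bound for `N λ_N` tends to `t (1 + (W - t) / (2 - t)) /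
W`. Its maximum over `t`, at `t = 2 - √(2 - W)`, is `B(W)`. The range `[1, 2]` comes from
Minkowski's theorem and from `ŵ_n ≤ 2n - 1`, which is again the resultant estimate. -/

/-! ### Geometry of numbers: short integer points orthogonal to given vectors. -/

/-- Minkowski's theorem on linear forms: the preimage of the box under `A` is convex and symmetric,
of volume `2 ^ card ι * ∏ b i / |det A|`. -/
theorem exists_int_ne_zero_abs_mulVec_le {ι : Type*} [Fintype ι] [DecidableEq ι]
    (A : Matrix ι ι ℝ) (hA : A.det ≠ 0) (b : ι → ℝ) (hb : ∀ i, 0 < b i)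
    (h : |A.det| < ∏ i, b i) :
    ∃ z : ι → ℤ, z ≠ 0 ∧ ∀ i, |A.mulVec (fun j => (z j : ℝ)) i| ≤ b i := by
  classical
  set s : Set (ι → ℝ) := (Matrix.toLin' A) ⁻¹' Set.Icc (-b) b with hs
  have hdet : LinearMap.det (Matrix.toLin' A) ≠ 0 := by rwa [LinearMap.det_toLin']
  have hconv : Convex ℝ s := (convex_Icc _ _).linear_preimage _
  have hsymm : ∀ x ∈ s, -x ∈ s := by
    intro x hx
    simp only [hs, Set.mem_preimage, Set.mem_Icc, map_neg] at hx ⊢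
    exact ⟨neg_le_neg hx.2, neg_le.mp hx.1⟩
  have hvol : MeasureTheory.volume (ZSpan.fundamentalDomain (Pi.basisFun ℝ ι)) *
      2 ^ Module.finrank ℝ (ι → ℝ) < MeasureTheory.volume s := by
    rw [hs, MeasureTheory.Measure.addHaar_preimage_linearMap _ hdet, Real.volume_Icc_pi,
      LinearMap.det_toLin', ZSpan.fundamentalDomain_pi_basisFun, MeasureTheory.volume_pi_pi]
    simp only [Real.volume_Ico, sub_zero, ENNReal.ofReal_one, Finset.prod_const_one, one_mul,
      Module.finrank_fintype_fun_eq_card, Pi.neg_apply, sub_neg_eq_add]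
    rw [← ENNReal.ofReal_prod_of_nonneg (fun i _ => by linarith [hb i]),
      ← ENNReal.ofReal_mul (abs_nonneg _), ← ENNReal.ofReal_ofNat, ← ENNReal.ofReal_pow (by norm_num)]
    have h2 : ∏ i, (b i + b i) = 2 ^ Fintype.card ι * ∏ i, b i := by
      simp_rw [← two_mul]
      rw [Finset.prod_mul_distrib, Finset.prod_const, Finset.card_univ]
    rw [h2]
    have hpos : 0 < |A.det| := abs_pos.mpr hA
    have key : (2 : ℝ) ^ Fintype.card ι < |(A.det)⁻¹| * (2 ^ Fintype.card ι * ∏ i, b i) := by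
      rw [abs_inv, ← div_eq_inv_mul, lt_div_iff₀ hpos]
      exact mul_lt_mul_of_pos_left h (by positivity)
    exact (ENNReal.ofReal_lt_ofReal_iff (lt_trans (by positivity) key)).mpr key
  have : Countable (Submodule.span ℤ (Set.range (Pi.basisFun ℝ ι))).toAddSubgroup :=
    inferInstanceAs (Countable (Submodule.span ℤ (Set.range (Pi.basisFun ℝ ι))))
  obtain ⟨x, hx0, hx⟩ :=
    MeasureTheory.exists_ne_zero_mem_lattice_of_measure_mul_two_pow_lt_measure
      (ZSpan.isAddFundamentalDomain' (Pi.basisFun ℝ ι) MeasureTheory.volume) hsymm hconv hvol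
  have hmem := ((Pi.basisFun ℝ ι).mem_span_iff_repr_mem ℤ (x : ι → ℝ)).mp x.2
  choose z hz using hmem
  have hz' : (x : ι → ℝ) = fun j => (z j : ℝ) := by
    funext j
    simpa using (hz j).symm
  refine ⟨z, ?_, fun i => ?_⟩
  · rintro rfl
    exact hx0 (Subtype.ext (by rw [hz']; funext j; simp))
  · rw [hs, Set.mem_preimage, hz', Matrix.toLin'_apply] at hx
    exact abs_le.mpr ⟨hx.1 i, hx.2 i⟩

/-- Steinitz exchange: while rows are missing, some standard basis vector lies outside the span. -/
theorem exists_linearIndependent_completion_single {ι : Type*} [Fintype ι] [DecidableEq ι]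
    (k : ℕ) (S : Finset ι) (hk : Sᶜ.card = k) (v : ι → ι → ℝ)
    (hv : LinearIndepOn ℝ v (S : Set ι)) :
    ∃ f : ι → ι, LinearIndependent ℝ
      (fun i => if i ∈ S then v i else Pi.single (f i) (1 : ℝ)) := by
  induction k generalizing S v with
  | zero =>
    have hS : S = Finset.univ := by simpa using hk
    subst hS
    refine ⟨id, ?_⟩
    simpa [linearIndepOn_univ_iff] using hv
  | succ k ih =>
    obtain ⟨i, hi⟩ : Sᶜ.Nonempty := Finset.card_pos.mp (by omega)
    have hiS : i ∉ S := by simpa using hi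
    obtain ⟨j, hj⟩ : ∃ j, Pi.single j (1 : ℝ) ∉ Submodule.span ℝ (v '' S) := by
      by_contra! hcon
      have htop : Submodule.span ℝ (v '' S) = ⊤ := by
        rw [eq_top_iff, ← (Pi.basisFun ℝ ι).span_eq, Submodule.span_le]
        rintro _ ⟨j, rfl⟩
        simpa using hcon j
      have h1 : Module.finrank ℝ (Submodule.span ℝ (v '' S)) ≤ S.card := by
        classical
        rw [← Finset.coe_image]
        exact (finrank_span_finset_le_card _).trans Finset.card_image_le
      rw [htop, finrank_top, Module.finrank_fintype_fun_eq_card] at h1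
      have := Finset.card_compl S
      omega
    have hins : LinearIndepOn ℝ (Function.update v i (Pi.single j 1))
        ((insert i S : Finset ι) : Set ι) := by
      rw [Finset.coe_insert]
      have heq : Set.EqOn (Function.update v i (Pi.single j 1)) v (S : Set ι) := fun x hx =>
        Function.update_of_ne (by rintro rfl; exact hiS hx) _ _
      refine LinearIndepOn.insert (hv.congr heq.symm) ?_
      rw [heq.image_eq]
      simpa using hj
    have hcard : (insert i S)ᶜ.card = k := by
      rw [Finset.compl_insert, Finset.card_erase_of_mem hi, hk]; rfl
    obtain ⟨f, hf⟩ := ih (insert i S) hcard _ hins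
    refine ⟨Function.update f i j, ?_⟩
    convert hf using 2 with a
    by_cases ha : a = i
    · subst ha; simp [hiS]
    · simp [ha]

theorem Matrix.abs_det_le_factorial_mul_prod {ι : Type*} [Fintype ι] [DecidableEq ι]
    (A : Matrix ι ι ℝ) (c : ι → ℝ) (h : ∀ i j, |A i j| ≤ c i) :
    |A.det| ≤ (Fintype.card ι).factorial * ∏ i, c i := by
  rw [Matrix.det_apply]
  refine (Finset.abs_sum_le_sum_abs _ _).trans ?_
  rw [← Fintype.card_perm, ← nsmul_eq_mul, ← Finset.card_univ]
  refine Finset.sum_le_card_nsmul _ _ _ fun σ _ => ?_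
  have : |Equiv.Perm.sign σ • ∏ i, A (σ i) i| = ∏ i, |A (σ i) i| := by
    rw [← Finset.abs_prod]
    rcases Int.units_eq_one_or (Equiv.Perm.sign σ) with h | h <;> simp [h]
  rw [this, ← Equiv.prod_comp σ c]
  exact Finset.prod_le_prod (fun _ _ => abs_nonneg _) fun i _ => h _ _

/-- Orthogonality comes from integrality: the pairings with the `v i` are integers, so making them
at most `1 / 2` makes them vanish. The rows `M i` express the `v i` in the coordinates `U z`;
completing them by standard basis vectors lets Minkowski's theorem control those coordinates too. -/
theorem exists_int_orthogonal_abs_mulVec_le {ι : Type*} [Fintype ι] [DecidableEq ι]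
    (U : Matrix ι ι ℝ) (hU : U.det ≠ 0) (S : Finset ι) (v : ι → ι → ℤ) (M : ι → ι → ℝ)
    (hM : ∀ i ∈ S, Matrix.vecMul (M i) U = fun j => (v i j : ℝ)) (E : ℝ)
    (hME : ∀ i ∈ S, ∀ j, |M i j| ≤ E)
    (hv : LinearIndepOn ℝ (fun i j => (v i j : ℝ)) (S : Set ι))
    (hvol : (Fintype.card ι).factorial * E ^ S.card * |U.det| < (1 / 2) ^ S.card) :
    ∃ z : ι → ℤ, z ≠ 0 ∧ (∀ i ∈ S, ∑ j, v i j * z j = 0) ∧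
      ∀ j, |U.mulVec (fun j => (z j : ℝ)) j| ≤ Fintype.card ι := by
  have hMlin : LinearIndepOn ℝ M (S : Set ι) := by
    have : LinearIndepOn ℝ (Matrix.vecMulLinear U ∘ M) (S : Set ι) := by
      refine hv.congr fun i hi => ?_
      simp only [Function.comp_apply, Matrix.vecMulLinear_apply]
      exact (hM i hi).symm
    exact this.of_comp _
  let A : (ι → ι) → Matrix ι ι ℝ := fun f =>
    Matrix.of fun i => if i ∈ S then M i else Pi.single (f i) (1 : ℝ)
  obtain ⟨f₀, hf₀⟩ := exists_linearIndependent_completion_single _ S rfl M hMlin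
  have : Nonempty (ι → ι) := ⟨f₀⟩
  -- Among all completions, take one of maximal determinant; this bounds the cofactors when `A f` is
  -- inverted below.
  obtain ⟨f, hf⟩ := Finite.exists_max fun f => |(A f).det|
  have hdet : (A f).det ≠ 0 := by
    have h0 : (A f₀).det ≠ 0 := by
      have := (Matrix.linearIndependent_rows_iff_isUnit (A := A f₀)).mp hf₀
      exact ((Matrix.isUnit_iff_isUnit_det _).mp this).ne_zero
    exact abs_pos.mp ((abs_pos.mpr h0).trans_le (hf f₀))
  set b : ι → ℝ := fun i => if i ∈ S then 1 / 2 else 1 with hb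
  have hprodb : ∏ i, b i = (1 / 2) ^ S.card := by
    simp [hb]
  have hprod : |(A f).det| ≤ (Fintype.card ι).factorial * E ^ S.card := by
    refine ((A f).abs_det_le_factorial_mul_prod (fun i => if i ∈ S then E else 1) ?_).trans ?_
    · intro i j
      by_cases hi : i ∈ S
      · simpa [A, hi] using hME i hi j
      · simp only [A, Matrix.of_apply, hi, if_false, Pi.single_apply]
        split_ifs <;> simp
    · simp
  obtain ⟨z, hz0, hz⟩ := exists_int_ne_zero_abs_mulVec_le (A f * U)
    (by rw [Matrix.det_mul]; exact mul_ne_zero hdet hU) b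
    (fun i => by simp only [hb]; split_ifs <;> norm_num) (by
      rw [Matrix.det_mul, abs_mul, hprodb]
      exact (mul_le_mul_of_nonneg_right hprod (abs_nonneg _)).trans_lt hvol)
  have horth : ∀ i ∈ S, ∑ j, v i j * z j = 0 := by
    intro i hi
    have h1 : (A f * U).mulVec (fun j => (z j : ℝ)) i = ((∑ j, v i j * z j : ℤ) : ℝ) := by
      have : (A f * U) i = fun j => (v i j : ℝ) := by
        rw [← hM i hi]
        funext j
        simp [Matrix.mul_apply, Matrix.vecMul, dotProduct, A, hi]
      rw [Matrix.mulVec, this]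
      simp [dotProduct]
    have h2 := hz i
    rw [h1] at h2
    simp only [hb, hi, if_true] at h2
    have h3 : |∑ j, v i j * z j| < 1 := by
      have : |((∑ j, v i j * z j : ℤ) : ℝ)| < 1 := h2.trans_lt (by norm_num)
      exact_mod_cast this
    exact Int.abs_lt_one_iff.mp h3
  refine ⟨z, hz0, horth, fun j => ?_⟩
  set y := U.mulVec (fun j => (z j : ℝ)) with hy
  set u := (A f).mulVec y with hu
  have hu' : u = (A f * U).mulVec (fun j => (z j : ℝ)) := by
    rw [hu, hy, Matrix.mulVec_mulVec]
  have huS : ∀ i ∈ S, u i = 0 := by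
    intro i hi
    have h1 : u i = ∑ a, M i a * y a := by simp [hu, Matrix.mulVec, dotProduct, A, hi]
    have h2 : ∑ a, M i a * y a = ∑ a, (v i a : ℝ) * z a := by
      have := Matrix.dotProduct_mulVec (M i) U (fun j => (z j : ℝ))
      rw [hM i hi] at this
      simpa [dotProduct] using this
    rw [h1, h2]
    exact_mod_cast horth i hi
  have huc : ∀ i, i ∉ S → |u i| ≤ 1 := by
    intro i hi
    have := hz i
    rw [← hu'] at this
    simpa [hb, hi] using this
  -- Cramer's rule. For `i ∉ S` the cofactor is the determinant of another completion, hence at most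
  -- the maximal one; for `i ∈ S` the factor `u i` is zero.
  have hadj : (A f).det * y j = ∑ i, (A f).adjugate j i * u i := by
    have : (A f).adjugate.mulVec u = (A f).det • y := by
      rw [hu, Matrix.mulVec_mulVec, Matrix.adjugate_mul, Matrix.smul_mulVec, Matrix.one_mulVec]
    have := congrFun this j
    simpa [Matrix.mulVec, dotProduct] using this.symm
  have hbound : ∀ i, |(A f).adjugate j i * u i| ≤ |(A f).det| := by
    intro i
    by_cases hi : i ∈ S
    · simp [huS i hi]
    · rw [abs_mul]
      have h1 : (A f).updateRow i (Pi.single j 1) = A (Function.update f i j) := by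
        ext a c
        by_cases ha : a = i
        · subst ha; simp [A, hi]
        · simp [A, ha]
      rw [Matrix.adjugate_apply, h1]
      calc _ ≤ |(A f).det| * 1 :=
            mul_le_mul (hf _) (huc i hi) (abs_nonneg _) (abs_nonneg _)
        _ = _ := mul_one _
  have hfin : |(A f).det| * |y j| ≤ |(A f).det| * Fintype.card ι := by
    rw [← abs_mul, hadj]
    refine (Finset.abs_sum_le_sum_abs _ _).trans ?_
    refine (Finset.sum_le_card_nsmul _ _ _ fun i _ => hbound i).trans ?_
    rw [nsmul_eq_mul, mul_comm, Finset.card_univ]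
  exact le_of_mul_le_mul_left hfin (abs_pos.mpr hdet)

/-! ### Mahler measure and good irreducible approximations. -/

/-- The Mahler measure of an integer polynomial. -/
noncomputable def intMahlerMeasure (P : Polynomial ℤ) : ℝ :=
  (P.map (Int.castRingHom ℂ)).mahlerMeasure

theorem one_le_intMahlerMeasure {P : Polynomial ℤ} (hP : P ≠ 0) : 1 ≤ intMahlerMeasure P :=
  Polynomial.one_le_mahlerMeasure_of_ne_zero hP

theorem intMahlerMeasure_mul (P Q : Polynomial ℤ) :
    intMahlerMeasure (P * Q) = intMahlerMeasure P * intMahlerMeasure Q := by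
  simp [intMahlerMeasure, Polynomial.mahlerMeasure_mul]

theorem abs_coeff_le_two_pow_mul_intMahlerMeasure {n : ℕ} {P : Polynomial ℤ}
    (hP : P.natDegree ≤ n) (i : ℕ) : |(P.coeff i : ℝ)| ≤ 2 ^ n * intMahlerMeasure P := by
  have h := (P.map (Int.castRingHom ℂ)).norm_coeff_le_choose_mul_mahlerMeasure i
  rw [Polynomial.coeff_map, eq_intCast, Complex.norm_intCast] at h
  refine h.trans (mul_le_mul_of_nonneg_right ?_ (Polynomial.mahlerMeasure_nonneg _))
  have h1 : (P.map (Int.castRingHom ℂ)).natDegree ≤ n := Polynomial.natDegree_map_le.trans hP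
  exact_mod_cast (Nat.choose_le_two_pow _ _).trans (Nat.pow_le_pow_right two_pos h1)

theorem intMahlerMeasure_le_of_abs_coeff_le {n : ℕ} {P : Polynomial ℤ} (hP : P.natDegree ≤ n)
    {B : ℝ} (hB : ∀ i, |(P.coeff i : ℝ)| ≤ B) : intMahlerMeasure P ≤ (n + 1) * B := by
  refine (Polynomial.mahlerMeasure_le_sum_norm_coeff _).trans ?_
  have h1 : (P.map (Int.castRingHom ℂ)).natDegree < n + 1 :=
    Nat.lt_succ_of_le (Polynomial.natDegree_map_le.trans hP)
  rw [Polynomial.sum_over_range' _ (by simp) _ h1]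
  refine (Finset.sum_le_card_nsmul _ _ B fun i _ => ?_).trans (by simp)
  rw [Polynomial.coeff_map, eq_intCast, Complex.norm_intCast]
  exact hB i

theorem Transcendental.aeval_int_ne_zero {ξ : ℝ} (hξ : Transcendental ℚ ξ) {P : Polynomial ℤ}
    (hP : P ≠ 0) : Polynomial.aeval ξ P ≠ 0 := by
  intro h0
  exact hξ ((IsFractionRing.isAlgebraic_iff ℤ ℚ ℝ).mp ⟨P, hP, h0⟩)

theorem LinearFormSolvable.exists_polynomial {n : ℕ} {ξ w X : ℝ} (hX : 1 ≤ X) (hw : 0 ≤ w)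
    (h : LinearFormSolvable (veronesePoint n ξ) w X) :
    ∃ R : Polynomial ℤ, R ≠ 0 ∧ R.natDegree ≤ n ∧ |Polynomial.aeval ξ R| ≤ X ^ (-w) ∧
      ∀ i, |(R.coeff i : ℝ)| ≤ (1 + ∑ j : Fin n, |ξ ^ ((j : ℕ) + 1)|) * X := by
  obtain ⟨a, x, hne, hx, hval⟩ := h
  have hsum : 0 ≤ ∑ j : Fin n, |ξ ^ ((j : ℕ) + 1)| := Finset.sum_nonneg fun _ _ => abs_nonneg _
  set R : Polynomial ℤ := Polynomial.ofFn (n + 1) (Fin.cons a x) with hR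
  have hcoeff : ∀ (i : ℕ) (hi : i < n + 1),
      R.coeff i = (Fin.cons a x : Fin (n + 1) → ℤ) ⟨i, hi⟩ := fun i hi =>
    Polynomial.ofFn_coeff_eq_val_of_lt _ hi
  have hdeg : R.natDegree < n + 1 := Polynomial.ofFn_natDegree_lt (Nat.le_add_left 1 n) _
  have hc0 : R.coeff 0 = a := hcoeff 0 (Nat.succ_pos n)
  have hcs : ∀ j : Fin n, R.coeff ((j : ℕ) + 1) = x j := fun j => by
    rw [hcoeff _ (Nat.succ_lt_succ j.2)]
    exact Fin.cons_succ (α := fun _ => ℤ) a x j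
  have haeval : Polynomial.aeval ξ R = (a : ℝ) + ∑ j, veronesePoint n ξ j * (x j : ℝ) := by
    rw [Polynomial.aeval_eq_sum_range' hdeg, Finset.sum_range, Fin.sum_univ_succ]
    simp [hc0, hcs, veronesePoint, mul_comm]
  have hXw : X ^ (-w) ≤ 1 := Real.rpow_le_one_of_one_le_of_nonpos hX (by linarith)
  have ha : |(a : ℝ)| ≤ (1 + ∑ j : Fin n, |ξ ^ ((j : ℕ) + 1)|) * X := by
    have h1 : |∑ j, veronesePoint n ξ j * (x j : ℝ)| ≤ (∑ j : Fin n, |ξ ^ ((j : ℕ) + 1)|) * X := by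
      rw [Finset.sum_mul]
      refine (Finset.abs_sum_le_sum_abs _ _).trans (Finset.sum_le_sum fun j _ => ?_)
      rw [abs_mul]
      exact mul_le_mul_of_nonneg_left (hx j) (abs_nonneg _)
    have h2 := abs_sub ((a : ℝ) + ∑ j, veronesePoint n ξ j * (x j : ℝ))
      (∑ j, veronesePoint n ξ j * (x j : ℝ))
    rw [add_sub_cancel_right] at h2
    linarith
  refine ⟨R, ?_, Nat.lt_succ_iff.mp hdeg, haeval ▸ hval, fun i => ?_⟩
  · intro h0
    refine hne ⟨by rw [← hc0, h0]; simp, ?_⟩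
    funext j
    rw [← hcs j, h0]; simp
  · rcases lt_or_ge i (n + 1) with hi | hi
    · rcases i with _ | i
      · rwa [hc0]
      · rw [hcs ⟨i, by omega⟩]
        refine (hx _).trans ?_
        nlinarith
    · rw [Polynomial.coeff_eq_zero_of_natDegree_lt (by omega)]
      simp only [Int.cast_zero, abs_zero]
      positivity

theorem eventually_mul_rpow_le_rpow (K : ℝ) {a b : ℝ} (h : a < b) :
    ∀ᶠ X : ℝ in atTop, K * X ^ a ≤ X ^ b := by
  filter_upwards [(tendsto_rpow_atTop (sub_pos.mpr h)).eventually_ge_atTop K,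
    eventually_gt_atTop 0] with X hX h0
  calc K * X ^ a ≤ X ^ (b - a) * X ^ a :=
        mul_le_mul_of_nonneg_right hX (Real.rpow_nonneg h0.le _)
    _ = X ^ b := by rw [← Real.rpow_add h0, sub_add_cancel]

/-- Both sides multiply along a factorization into irreducibles. Constant factors have absolute
value at least `1` and cost no power of `c`, so the total loss depends only on the degree. -/
theorem pow_mul_rpow_intMahlerMeasure_le_abs_aeval {ξ w c : ℝ} {n : ℕ} (hw : 0 ≤ w) (hc : 0 ≤ c)
    (hc1 : c ≤ 1)
    (h : ∀ P : Polynomial ℤ, Irreducible P → P.natDegree ≤ n →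
      c * intMahlerMeasure P ^ (-w) ≤ |Polynomial.aeval ξ P|) (R : Polynomial ℤ) :
    R ≠ 0 → R.natDegree ≤ n →
      c ^ R.natDegree * intMahlerMeasure R ^ (-w) ≤ |Polynomial.aeval ξ R| := by
  have hM : ∀ R : Polynomial ℤ, R ≠ 0 → intMahlerMeasure R ^ (-w) ≤ 1 := fun R hR =>
    Real.rpow_le_one_of_one_le_of_nonpos (one_le_intMahlerMeasure hR) (by linarith)
  have hconst : ∀ R : Polynomial ℤ, R ≠ 0 → R.natDegree = 0 → 1 ≤ |Polynomial.aeval ξ R| := by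
    intro R hR h0
    obtain ⟨a, rfl⟩ := Polynomial.natDegree_eq_zero.mp h0
    have ha : a ≠ 0 := by rintro rfl; simp at hR
    simpa using (show (1 : ℝ) ≤ |(a : ℝ)| by exact_mod_cast Int.one_le_abs ha)
  induction R using WfDvdMonoid.induction_on_irreducible with
  | zero => exact fun h => absurd rfl h
  | unit u hu =>
    intro h0 _
    have hd := Polynomial.natDegree_eq_zero_of_isUnit hu
    rw [hd, pow_zero, one_mul]
    exact (hM u h0).trans (hconst u h0 hd)
  | mul a P ha hP ih =>
    intro _ hdeg
    rw [Polynomial.natDegree_mul hP.ne_zero ha] at hdeg ⊢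
    have iha := ih ha (by omega)
    have hP' : c ^ P.natDegree * intMahlerMeasure P ^ (-w) ≤ |Polynomial.aeval ξ P| := by
      rcases Nat.eq_zero_or_pos P.natDegree with h0 | h0
      · rw [h0, pow_zero, one_mul]
        exact (hM P hP.ne_zero).trans (hconst P hP.ne_zero h0)
      · refine le_trans (mul_le_mul_of_nonneg_right ?_ ?_) (h P hP (by omega))
        · exact pow_le_of_le_one hc hc1 h0.ne'
        · exact Real.rpow_nonneg (Polynomial.mahlerMeasure_nonneg _) _
    have hnn : ∀ R : Polynomial ℤ, 0 ≤ intMahlerMeasure R := fun R =>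
      Polynomial.mahlerMeasure_nonneg _
    rw [intMahlerMeasure_mul, map_mul, abs_mul, Real.mul_rpow (hnn _) (hnn _), pow_add,
      mul_mul_mul_comm]
    exact mul_le_mul hP' iha (mul_nonneg (pow_nonneg hc _) (Real.rpow_nonneg (hnn _) _))
      (abs_nonneg _)

/-- Otherwise irreducible polynomials, hence all nonzero polynomials of degree at most `n`, would be
bounded below at `ξ` with exponent `w' < w`, against the solvability with exponent `w`. -/
theorem exists_irreducible_abs_aeval_le {ξ : ℝ} (hξ : Transcendental ℚ ξ) {n : ℕ} {w w' : ℝ}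
    (hw' : 0 < w') (hww' : w' < w)
    (hsol : ∀ᶠ X : ℝ in atTop, LinearFormSolvable (veronesePoint n ξ) w X) (T : ℝ) :
    ∃ P : Polynomial ℤ, Irreducible P ∧ P.natDegree ≤ n ∧ T ≤ intMahlerMeasure P ∧
      |Polynomial.aeval ξ P| ≤ intMahlerMeasure P ^ (-w') := by
  by_contra! hcon
  have hfin := Polynomial.finite_mahlerMeasure_le n T.toNNReal
  -- Only finitely many polynomials have Mahler measure below `T`, and none but zero vanishes at the
  -- transcendental `ξ`; one constant serves them all.
  obtain ⟨c, hcF, hc0, hc1⟩ : ∃ c : ℝ, (∀ P ∈ {p : Polynomial ℤ | p.natDegree ≤ n ∧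
      (p.map (Int.castRingHom ℂ)).mahlerMeasure ≤ T.toNNReal}, P ≠ 0 →
        c ≤ |Polynomial.aeval ξ P|) ∧ 0 < c ∧ c ≤ 1 := by
    have hev : ∀ᶠ c : ℝ in 𝓝[>] 0, ∀ P ∈ {p : Polynomial ℤ | p.natDegree ≤ n ∧
        (p.map (Int.castRingHom ℂ)).mahlerMeasure ≤ T.toNNReal}, P ≠ 0 →
          c ≤ |Polynomial.aeval ξ P| := by
      refine (eventually_all_finite hfin).mpr fun P _ => ?_
      by_cases hP : P = 0
      · simp [hP]
      · have hpos := abs_pos.mpr (hξ.aeval_int_ne_zero hP)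
        filter_upwards [nhdsWithin_le_nhds (eventually_le_nhds hpos)] with c hc _ using hc
    obtain ⟨c, h1, h2, h3⟩ := (hev.and (eventually_mem_nhdsWithin.and
      (nhdsWithin_le_nhds (eventually_le_nhds one_pos)))).exists
    exact ⟨c, h1, h2, h3⟩
  have hM1 : ∀ P : Polynomial ℤ, P ≠ 0 → intMahlerMeasure P ^ (-w') ≤ 1 := fun P hP =>
    Real.rpow_le_one_of_one_le_of_nonpos (one_le_intMahlerMeasure hP) (by linarith)
  have hlow := pow_mul_rpow_intMahlerMeasure_le_abs_aeval (ξ := ξ) (n := n) hw'.le hc0.le hc1 (by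
    intro P hP hdeg
    have hnn : 0 ≤ intMahlerMeasure P ^ (-w') :=
      Real.rpow_nonneg (Polynomial.mahlerMeasure_nonneg _) _
    rcases le_or_gt T (intMahlerMeasure P) with hT | hT
    · nlinarith [hcon P hP hdeg hT]
    · have := hcF P ⟨hdeg, hT.le.trans (Real.le_coe_toNNReal T)⟩ hP.ne_zero
      nlinarith [hM1 P hP.ne_zero])
  set C : ℝ := (n + 1) * (1 + ∑ j : Fin n, |ξ ^ ((j : ℕ) + 1)|) with hC
  have hCpos : 0 < C := by positivity
  have hlim := eventually_mul_rpow_le_rpow (2 / (c ^ n * C ^ (-w'))) (a := -w) (b := -w')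
    (by linarith)
  obtain ⟨X, hX, hX1, hlX⟩ := (hsol.and ((eventually_ge_atTop 1).and hlim)).exists
  obtain ⟨R, hR0, hRdeg, hRval, hRc⟩ := hX.exists_polynomial hX1 (by linarith)
  have hX0 : 0 < X := by linarith
  have hMR : intMahlerMeasure R ≤ C * X := by
    rw [hC, mul_assoc]
    exact intMahlerMeasure_le_of_abs_coeff_le hRdeg hRc
  have hMpos : 0 < intMahlerMeasure R := one_pos.trans_le (one_le_intMahlerMeasure hR0)
  have h1 : (C * X) ^ (-w') ≤ intMahlerMeasure R ^ (-w') :=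
    Real.rpow_le_rpow_of_nonpos hMpos hMR (by linarith)
  rw [Real.mul_rpow hCpos.le hX0.le] at h1
  have h2 : c ^ n ≤ c ^ R.natDegree := pow_le_pow_of_le_one hc0.le hc1 hRdeg
  have hXw : 0 < X ^ (-w) := Real.rpow_pos_of_pos hX0 _
  have hK : 0 < c ^ n * C ^ (-w') := mul_pos (pow_pos hc0 _) (Real.rpow_pos_of_pos hCpos _)
  have h3 : c ^ n * (C ^ (-w') * X ^ (-w')) ≤ X ^ (-w) :=
    (mul_le_mul h2 h1 (by positivity) (by positivity)).trans ((hlow R hR0 hRdeg).trans hRval)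
  rw [div_mul_eq_mul_div, div_le_iff₀ hK] at hlX
  nlinarith

/-- Uniformity in `X` is what supplies `Q`: solve the system at a height slightly below that of `P`.
Then `Q` has smaller Mahler measure than `P`, so it cannot be a multiple of `P`. -/
theorem exists_irreducible_and_not_dvd {ξ : ℝ} (hξ : Transcendental ℚ ξ) {n : ℕ} {w w' : ℝ}
    (hw' : 0 < w') (hww' : w' < w)
    (hsol : ∀ᶠ X : ℝ in atTop, LinearFormSolvable (veronesePoint n ξ) w X) (T : ℝ) :
    ∃ (P Q : Polynomial ℤ) (H : ℝ), T ≤ H ∧ Irreducible P ∧ ¬ P ∣ Q ∧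
      P.natDegree ≤ n ∧ Q.natDegree ≤ n ∧
      (∀ i, |(P.coeff i : ℝ)| ≤ H) ∧ (∀ i, |(Q.coeff i : ℝ)| ≤ H) ∧
      |Polynomial.aeval ξ P| ≤ H ^ (-w') ∧ |Polynomial.aeval ξ Q| ≤ H ^ (-w') := by
  obtain ⟨w'', hw1, hw2⟩ := exists_between hww'
  set D : ℝ := 1 + ∑ j : Fin n, |ξ ^ ((j : ℕ) + 1)| with hD
  have hD1 : 1 ≤ D := by
    rw [hD]; exact le_add_of_nonneg_right (Finset.sum_nonneg fun _ _ => abs_nonneg _)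
  set C : ℝ := (n + 1) * D with hC
  have hDC : D ≤ C := by rw [hC]; nlinarith [(Nat.cast_nonneg n : (0 : ℝ) ≤ n)]
  -- With `H = 2 ^ n * M(P)` and `X = H / K`, the bound `C * X` for `M(Q)` equals `M(P) / 2`.
  set K : ℝ := 2 ^ n * (2 * C) with hKdef
  have hK : 0 < K := by positivity
  have hlim : Tendsto (fun H : ℝ => H / K) atTop atTop := tendsto_id.atTop_div_const hK
  obtain ⟨T₀, hT₀⟩ := eventually_atTop.mp
    ((eventually_mul_rpow_le_rpow ((2 ^ n : ℝ) ^ w'') (neg_lt_neg hw1)).and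
      ((eventually_mul_rpow_le_rpow (K ^ w) (neg_lt_neg hww')).and
        ((hlim.eventually hsol).and (hlim.eventually_ge_atTop 1))))
  obtain ⟨P, hPirr, hPdeg, hPM, hPval⟩ := exists_irreducible_abs_aeval_le hξ (hw'.trans hw1) hw2
    hsol (max T₀ T)
  set M := intMahlerMeasure P with hM
  have hM1 : 1 ≤ M := one_le_intMahlerMeasure hPirr.ne_zero
  set H : ℝ := 2 ^ n * M with hH
  have h2n : (1 : ℝ) ≤ 2 ^ n := one_le_pow₀ (by norm_num)
  have hMH : M ≤ H := by rw [hH]; nlinarith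
  have hH0 : 0 < H := by linarith
  obtain ⟨hE1, hE2, hsolX, hX1⟩ := hT₀ H ((le_max_left _ _).trans (hPM.trans hMH))
  obtain ⟨Q, hQ0, hQdeg, hQval, hQc⟩ := hsolX.exists_polynomial hX1 (by linarith)
  have hHK : H / K = M / (2 * C) := by
    rw [hH, hKdef]; field_simp
  have hCX : C * (H / K) = M / 2 := by
    have hC0 : C ≠ 0 := by linarith
    rw [hHK]; field_simp
  refine ⟨P, Q, H, (le_max_right _ _).trans (hPM.trans hMH), hPirr, ?_, hPdeg, hQdeg, ?_, ?_, ?_, ?_⟩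
  · rintro ⟨S, rfl⟩
    have h1 : intMahlerMeasure (P * S) ≤ M / 2 := by
      rw [← hCX, hC, mul_assoc]
      exact intMahlerMeasure_le_of_abs_coeff_le hQdeg hQc
    rw [intMahlerMeasure_mul] at h1
    have := one_le_intMahlerMeasure (right_ne_zero_of_mul hQ0)
    nlinarith
  · exact abs_coeff_le_two_pow_mul_intMahlerMeasure hPdeg
  · intro i
    refine (hQc i).trans ((mul_le_mul_of_nonneg_right hDC (by positivity)).trans ?_)
    rw [hCX]; linarith
  · refine hPval.trans (le_trans (le_of_eq ?_) hE1)
    have : M = H / 2 ^ n := by rw [hH]; field_simp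
    rw [this, Real.div_rpow hH0.le (by positivity), Real.rpow_neg (by positivity : (0:ℝ) ≤ 2 ^ n),
      div_inv_eq_mul, mul_comm]
  · refine hQval.trans (le_trans (le_of_eq ?_) hE2)
    rw [Real.div_rpow hH0.le hK.le, Real.rpow_neg hK.le, div_inv_eq_mul, mul_comm]

/-! ### Coprimality and independence of the shifts. -/

theorem Irreducible.isCoprime_map_real {P Q : Polynomial ℤ} (hP : Irreducible P)
    (hdeg : P.natDegree ≠ 0) (hPQ : ¬ P ∣ Q) :
    IsCoprime (P.map (Int.castRingHom ℝ)) (Q.map (Int.castRingHom ℝ)) := by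
  have hprim := hP.isPrimitive hdeg
  have hirr : Irreducible (P.map (Int.castRingHom ℚ)) :=
    (Polynomial.IsPrimitive.Int.irreducible_iff_irreducible_map_cast hprim).mp hP
  have hco : IsCoprime (P.map (Int.castRingHom ℚ)) (Q.map (Int.castRingHom ℚ)) :=
    hirr.coprime_iff_not_dvd.mpr fun h =>
      hPQ (hprim.dvd_of_fraction_map_dvd_fraction_map (K := ℚ) h)
  have h := hco.map (Polynomial.mapRingHom (algebraMap ℚ ℝ))
  simp only [Polynomial.coe_mapRingHom, Polynomial.map_map] at h
  rwa [RingHom.ext_int ((algebraMap ℚ ℝ).comp (Int.castRingHom ℚ)) (Int.castRingHom ℝ)] at h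

/-- By coprimality over `ℝ` (Gauss's lemma), a relation forces `P ∣ B`, which the degree of `B`
excludes unless `B = 0`. -/
theorem Irreducible.eq_zero_of_mul_map_add_mul_map_eq_zero {P Q : Polynomial ℤ}
    (hP : Irreducible P) (hPQ : ¬ P ∣ Q) {A B : Polynomial ℝ}
    (hB : B.degree < P.natDegree)
    (h : A * P.map (Int.castRingHom ℝ) + B * Q.map (Int.castRingHom ℝ) = 0) : A = 0 ∧ B = 0 := by
  have hPdeg : (P.map (Int.castRingHom ℝ)).degree = P.natDegree := by
    rw [Polynomial.degree_map_eq_of_injective (Int.castRingHom ℝ).injective_int,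
      Polynomial.degree_eq_natDegree hP.ne_zero]
  have hB0 : B = 0 := by
    by_cases h0 : P.natDegree = 0
    · rw [h0] at hB
      exact Polynomial.degree_eq_bot.mp (Nat.WithBot.lt_zero_iff.mp hB)
    · have hdvd : P.map (Int.castRingHom ℝ) ∣ B * Q.map (Int.castRingHom ℝ) :=
        ⟨-A, by linear_combination h⟩
      have := (hP.isCoprime_map_real h0 hPQ).dvd_of_dvd_mul_right hdvd
      exact Polynomial.eq_zero_of_dvd_of_degree_lt this (hPdeg ▸ hB)
  refine ⟨?_, hB0⟩
  rw [hB0, zero_mul, add_zero] at h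
  refine (mul_eq_zero.mp h).resolve_right fun h0 => ?_
  rw [h0, Polynomial.degree_zero] at hPdeg
  exact absurd hPdeg.symm (WithBot.natCast_ne_bot _)

/-- The polynomials `P, X P, …, X ^ (k - 1) P, Q, X Q, …`. -/
noncomputable def shiftFamily (P Q : Polynomial ℤ) (k i : ℕ) : Polynomial ℤ :=
  if i < k then Polynomial.X ^ i * P else Polynomial.X ^ (i - k) * Q

/-- A linear relation among the shifts is a relation `A P + B Q = 0` with `deg B < l ≤ deg P`. -/
theorem linearIndepOn_coeff_shiftFamily {P Q : Polynomial ℤ} (hP : Irreducible P)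
    (hPQ : ¬ P ∣ Q) {k l N : ℕ} (hl : l ≤ P.natDegree) (hkl : k + l ≤ N + 1)
    (hdeg : ∀ i < k + l, (shiftFamily P Q k i).natDegree ≤ N) :
    LinearIndepOn ℝ (fun (i j : Fin (N + 1)) => ((shiftFamily P Q k i).coeff j : ℝ))
      ((Finset.univ.filter fun i : Fin (N + 1) => (i : ℕ) < k + l : Finset _) : Set _) := by
  rw [linearIndepOn_finset_iff]
  intro g hg i hi
  set g' : ℕ → ℝ := fun i => if h : i < N + 1 then g ⟨i, h⟩ else 0 with hg'
  have hgg' : ∀ i : Fin (N + 1), g i = g' i := fun i => by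
    simp only [hg', dif_pos i.2]
  have hsum : ∑ i ∈ Finset.range (k + l), Polynomial.C (g' i) *
      (shiftFamily P Q k i).map (Int.castRingHom ℝ) = 0 := by
    ext j
    rw [Polynomial.finsetSum_coeff, Polynomial.coeff_zero]
    simp only [Polynomial.coeff_C_mul, Polynomial.coeff_map, eq_intCast]
    rcases lt_or_ge j (N + 1) with hj | hj
    · have h1 := congrFun hg ⟨j, hj⟩
      rw [Finset.sum_apply, Finset.sum_filter] at h1
      simp only [Pi.smul_apply, smul_eq_mul, Pi.zero_apply, hgg'] at h1
      rw [Fin.sum_univ_eq_sum_range (fun i => if i < k + l then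
        g' i * ((shiftFamily P Q k i).coeff j : ℝ) else 0), ← Finset.sum_filter] at h1
      rw [← h1]
      refine Finset.sum_congr ?_ fun _ _ => rfl
      ext i
      simp only [Finset.mem_range, Finset.mem_filter]
      omega
    · refine Finset.sum_eq_zero fun i hi => ?_
      rw [Polynomial.coeff_eq_zero_of_natDegree_lt]
      · simp
      · exact (hdeg i (Finset.mem_range.mp hi)).trans_lt (by omega)
  set A : Polynomial ℝ := ∑ i ∈ Finset.range k, Polynomial.monomial i (g' i) with hA
  set B : Polynomial ℝ := ∑ i ∈ Finset.range l, Polynomial.monomial i (g' (k + i)) with hB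
  have hAB : A * P.map (Int.castRingHom ℝ) + B * Q.map (Int.castRingHom ℝ) = 0 := by
    rw [← hsum, Finset.sum_range_add, hA, hB, Finset.sum_mul, Finset.sum_mul]
    congr 1
    · refine Finset.sum_congr rfl fun i hi => ?_
      rw [shiftFamily, if_pos (Finset.mem_range.mp hi)]
      simp [← Polynomial.C_mul_X_pow_eq_monomial, mul_assoc]
    · refine Finset.sum_congr rfl fun i hi => ?_
      rw [shiftFamily, if_neg (by omega)]
      simp [← Polynomial.C_mul_X_pow_eq_monomial, mul_assoc]
  have hBdeg : B.degree < P.natDegree := by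
    refine lt_of_lt_of_le ?_ (Nat.cast_le.mpr hl)
    refine (Polynomial.degree_sum_le _ _).trans_lt ?_
    rw [Finset.sup_lt_iff (WithBot.bot_lt_coe _)]
    intro i hi
    exact (Polynomial.degree_monomial_le _ _).trans_lt
      (by exact_mod_cast Finset.mem_range.mp hi)
  obtain ⟨hA0, hB0⟩ := hP.eq_zero_of_mul_map_add_mul_map_eq_zero hPQ hBdeg hAB
  have hi' : (i : ℕ) < k + l := (Finset.mem_filter.mp hi).2
  rw [hgg']
  rcases lt_or_ge (i : ℕ) k with hik | hik
  · have := congrArg (fun F => Polynomial.coeff F (i : ℕ)) hA0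
    simpa [hA, Polynomial.finsetSum_coeff, Polynomial.coeff_monomial, hik] using this
  · have := congrArg (fun F => Polynomial.coeff F ((i : ℕ) - k)) hB0
    have h2 : (i : ℕ) - k < l := by omega
    simpa [hB, Polynomial.finsetSum_coeff, Polynomial.coeff_monomial, h2,
      Nat.add_sub_cancel' hik] using this

/-! ### Duality between polynomials and simultaneous approximation. -/

/-- The matrix of the linear forms `z_0 / X` and `(z_j - ξ ^ j z_0) / Y` for `1 ≤ j ≤ N`. -/
noncomputable def simultaneousMatrix (N : ℕ) (ξ X Y : ℝ) : Matrix (Fin (N + 1)) (Fin (N + 1)) ℝ :=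
  Matrix.of fun i j => if i = j then (if i = 0 then X⁻¹ else Y⁻¹)
    else if j = 0 then -ξ ^ (i : ℕ) * Y⁻¹ else 0

theorem det_simultaneousMatrix (N : ℕ) (ξ X Y : ℝ) :
    (simultaneousMatrix N ξ X Y).det = (X * Y ^ N)⁻¹ := by
  rw [Matrix.det_of_isLowerTriangular]
  · rw [Fin.prod_univ_succ]
    simp [simultaneousMatrix, mul_comm]
  · intro i j hij
    have hij : i < j := hij
    simp [simultaneousMatrix, hij.ne, (Fin.zero_le i).trans_lt hij |>.ne']

theorem simultaneousMatrix_mulVec_zero (N : ℕ) (ξ X Y : ℝ) (z : Fin (N + 1) → ℝ) :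
    (simultaneousMatrix N ξ X Y).mulVec z 0 = X⁻¹ * z 0 := by
  simp [Matrix.mulVec, dotProduct, simultaneousMatrix, Fin.sum_univ_succ, Fin.succ_ne_zero,
    (Fin.succ_ne_zero _).symm]

theorem simultaneousMatrix_mulVec_succ (N : ℕ) (ξ X Y : ℝ) (z : Fin (N + 1) → ℝ) (j : Fin N) :
    (simultaneousMatrix N ξ X Y).mulVec z j.succ = Y⁻¹ * (z j.succ - ξ ^ ((j : ℕ) + 1) * z 0) := by
  simp [Matrix.mulVec, dotProduct, simultaneousMatrix, Fin.sum_univ_succ, Fin.succ_ne_zero]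
  ring

/-- This is the identity `∑ R_j z_j = R(ξ) z_0 + ∑_{j ≥ 1} R_j (z_j - ξ ^ j z_0)`: a polynomial of
small value and controlled height has small coordinates. -/
theorem vecMul_simultaneousMatrix (N : ℕ) {ξ X Y : ℝ} (hX : X ≠ 0) (hY : Y ≠ 0)
    {R : Polynomial ℤ} (hR : R.natDegree ≤ N) :
    Matrix.vecMul (Fin.cons (Polynomial.aeval ξ R * X) fun j : Fin N => (R.coeff (j + 1) : ℝ) * Y)
      (simultaneousMatrix N ξ X Y) = fun j : Fin (N + 1) => (R.coeff j : ℝ) := by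
  have haeval : Polynomial.aeval ξ R = (R.coeff 0 : ℝ) +
      ∑ j : Fin N, (R.coeff ((j : ℕ) + 1) : ℝ) * ξ ^ ((j : ℕ) + 1) := by
    rw [Polynomial.aeval_eq_sum_range' (Nat.lt_succ_of_le hR), Finset.sum_range,
      Fin.sum_univ_succ]
    simp
  funext j
  refine Fin.cases ?_ (fun j => ?_) j
  · simp only [Matrix.vecMul, dotProduct, simultaneousMatrix, Fin.sum_univ_succ, Fin.cons_zero,
      Fin.cons_succ, Matrix.of_apply, if_true, Fin.succ_ne_zero, if_false, Fin.val_succ,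
      Fin.val_zero]
    rw [mul_assoc, mul_inv_cancel₀ hX, mul_one, haeval, add_assoc, ← Finset.sum_add_distrib]
    simp only [add_eq_left]
    refine Finset.sum_eq_zero fun i _ => ?_
    field_simp
    ring
  · simp [Matrix.vecMul, dotProduct, simultaneousMatrix, hY]

theorem exists_int_orthogonal_coeff {N d : ℕ} (hd : d ≤ N + 1) {ξ X Y E : ℝ} (hX : 0 < X)
    (hY : 0 < Y) (R : ℕ → Polynomial ℤ) (hdeg : ∀ i < d, (R i).natDegree ≤ N)
    (hlin : LinearIndepOn ℝ (fun (i j : Fin (N + 1)) => ((R i).coeff j : ℝ))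
      ((Finset.univ.filter fun i : Fin (N + 1) => (i : ℕ) < d : Finset _) : Set _))
    (hval : ∀ i < d, |Polynomial.aeval ξ (R i)| * X ≤ E)
    (hcoeff : ∀ i < d, ∀ j, |((R i).coeff j : ℝ)| * Y ≤ E)
    (hvol : (N + 1).factorial * (2 * E) ^ d < X * Y ^ N) :
    ∃ z : Fin (N + 1) → ℤ, z ≠ 0 ∧ (∀ i < d, ∑ j : Fin (N + 1), (R i).coeff j * z j = 0) ∧
      |(z 0 : ℝ)| ≤ (N + 1) * X ∧
      ∀ j : Fin N, |ξ ^ ((j : ℕ) + 1) * (z 0 : ℝ) - z j.succ| ≤ (N + 1) * Y := by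
  set S := Finset.univ.filter fun i : Fin (N + 1) => (i : ℕ) < d with hS
  have hcard : S.card = d := by
    rw [hS, Fin.card_filter_val_lt, min_eq_right hd]
  have hXY : 0 < X * Y ^ N := by positivity
  obtain ⟨z, hz0, horth, hz⟩ := exists_int_orthogonal_abs_mulVec_le (simultaneousMatrix N ξ X Y)
    (by rw [det_simultaneousMatrix]; exact (inv_pos.mpr hXY).ne') S
    (fun i j => (R i).coeff j)
    (fun i => Fin.cons (Polynomial.aeval ξ (R i) * X)
      fun j : Fin N => ((R i).coeff (j + 1) : ℝ) * Y)
    (fun i hi => vecMul_simultaneousMatrix N hX.ne' hY.ne' (hdeg i (Finset.mem_filter.mp hi).2)) E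
    (by
      intro i hi j
      have hi' := (Finset.mem_filter.mp hi).2
      refine Fin.cases ?_ (fun j => ?_) j
      · simpa [abs_mul, abs_of_pos hX] using hval i hi'
      · simpa [abs_mul, abs_of_pos hY] using hcoeff i hi' (j + 1))
    hlin (by
      rw [det_simultaneousMatrix, hcard, Fintype.card_fin, abs_of_pos (inv_pos.mpr hXY),
        ← div_eq_mul_inv, div_lt_iff₀ hXY, one_div, inv_pow, ← div_eq_inv_mul,
        lt_div_iff₀ (by positivity), mul_assoc, ← mul_pow, mul_comm E 2]
      exact hvol)
  refine ⟨z, hz0, fun i hi => ?_, ?_, fun j => ?_⟩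
  · exact horth ⟨i, hi.trans_le hd⟩ (by simp [hS, hi])
  · have := hz 0
    rw [simultaneousMatrix_mulVec_zero, abs_mul, abs_inv, abs_of_pos hX, ← div_eq_inv_mul,
      div_le_iff₀ hX, Fintype.card_fin] at this
    simpa using this
  · have := hz j.succ
    rw [simultaneousMatrix_mulVec_succ, abs_mul, abs_inv, abs_of_pos hY, ← div_eq_inv_mul,
      div_le_iff₀ hY, Fintype.card_fin] at this
    rw [abs_sub_comm]
    simpa using this

theorem abs_coeff_shiftFamily_le {P Q : Polynomial ℤ} {H : ℝ} (hH : 0 ≤ H)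
    (hP : ∀ i, |(P.coeff i : ℝ)| ≤ H) (hQ : ∀ i, |(Q.coeff i : ℝ)| ≤ H) (k i j : ℕ) :
    |((shiftFamily P Q k i).coeff j : ℝ)| ≤ H := by
  unfold shiftFamily
  split_ifs <;> rw [Polynomial.coeff_X_pow_mul'] <;> split_ifs <;> simp [hP, hQ, hH]

theorem abs_aeval_shiftFamily_le {P Q : Polynomial ℤ} {ξ δ : ℝ}
    (hP : |Polynomial.aeval ξ P| ≤ δ) (hQ : |Polynomial.aeval ξ Q| ≤ δ) (k : ℕ) {i N : ℕ}
    (hi : i ≤ N) : |Polynomial.aeval ξ (shiftFamily P Q k i)| ≤ (1 + |ξ|) ^ N * δ := by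
  have hpow : ∀ a ≤ N, |ξ| ^ a ≤ (1 + |ξ|) ^ N := fun a ha =>
    (pow_le_pow_left₀ (abs_nonneg ξ) (by linarith) a).trans
      (pow_le_pow_right₀ (by linarith [abs_nonneg ξ]) ha)
  unfold shiftFamily
  split_ifs <;> rw [map_mul, map_pow, Polynomial.aeval_X, abs_mul, abs_pow]
  · exact mul_le_mul (hpow _ hi) hP (abs_nonneg _) (by positivity)
  · exact mul_le_mul (hpow _ (by omega)) hQ (abs_nonneg _) (by positivity)

theorem natDegree_shiftFamily_le {P Q : Polynomial ℤ} {k l N : ℕ} (hP : k + P.natDegree ≤ N + 1)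
    (hQ : l + Q.natDegree ≤ N + 1) {i : ℕ} (hi : i < k + l) :
    (shiftFamily P Q k i).natDegree ≤ N := by
  unfold shiftFamily
  split_ifs with h <;> refine Polynomial.natDegree_mul_le.trans ?_ <;>
    rw [Polynomial.natDegree_X_pow] <;> omega

/-! ### Resultant-type estimate and the upper bound for the uniform exponent. -/

/-- This replaces a resultant estimate: `n` shifts of `P` and `deg P` shifts of `Q` form a basis of
the whole space, so no nonzero `z` is orthogonal to all of them. The volume condition that would
produce one must therefore fail. -/
theorem one_le_of_irreducible_of_not_dvd {P Q : Polynomial ℤ} (hP : Irreducible P)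
    (hPQ : ¬ P ∣ Q) {n N : ℕ} (hN : n + P.natDegree = N + 1) (hQ : Q.natDegree ≤ n)
    {ξ δ H : ℝ} (hδ : 0 < δ) (hH : 0 < H)
    (hPc : ∀ i, |(P.coeff i : ℝ)| ≤ H) (hQc : ∀ i, |(Q.coeff i : ℝ)| ≤ H)
    (hPv : |Polynomial.aeval ξ P| ≤ δ) (hQv : |Polynomial.aeval ξ Q| ≤ δ) :
    1 ≤ (N + 1).factorial * 2 ^ (N + 1) * (1 + |ξ|) ^ N * δ * H ^ N := by
  by_contra! hcon
  have hD : 0 < (1 + |ξ|) ^ N * δ := by positivity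
  have hdeg : ∀ i < n + P.natDegree, (shiftFamily P Q n i).natDegree ≤ N := fun i hi =>
    natDegree_shiftFamily_le (l := P.natDegree) hN.le (by omega) hi
  have hlin := linearIndepOn_coeff_shiftFamily hP hPQ (k := n) le_rfl hN.le hdeg
  obtain ⟨z, hz0, horth, -⟩ := exists_int_orthogonal_coeff (E := 1) hN.le
    (inv_pos.mpr hD) (inv_pos.mpr hH) (shiftFamily P Q n) hdeg hlin
    (fun i hi => by
      rw [← div_eq_mul_inv, div_le_one hD]
      exact abs_aeval_shiftFamily_le hPv hQv n (by omega))
    (fun i _ j => by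
      rw [← div_eq_mul_inv, div_le_one hH]
      exact abs_coeff_shiftFamily_le hH.le hPc hQc n i j)
    (by
      rw [hN, mul_one, inv_pow, ← mul_inv, ← one_div, lt_div_iff₀ (by positivity)]
      linarith)
  have huniv : (Finset.univ.filter fun i : Fin (N + 1) => (i : ℕ) < n + P.natDegree) =
      Finset.univ := by
    ext i; simp only [Finset.mem_filter, Finset.mem_univ, true_and, iff_true]; omega
  rw [huniv, Finset.coe_univ, linearIndepOn_univ_iff] at hlin
  set B : Matrix (Fin (N + 1)) (Fin (N + 1)) ℝ :=
    Matrix.of fun i j => ((shiftFamily P Q n i).coeff j : ℝ) with hB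
  have hdet : B.det ≠ 0 :=
    ((Matrix.isUnit_iff_isUnit_det _).mp
      ((Matrix.linearIndependent_rows_iff_isUnit (A := B)).mp hlin)).ne_zero
  have h0 := Matrix.eq_zero_of_mulVec_eq_zero hdet (v := fun j => (z j : ℝ)) (by
    funext i
    simp only [Matrix.mulVec, dotProduct, hB, Matrix.of_apply, Pi.zero_apply]
    exact_mod_cast horth i (by omega))
  refine hz0 (funext fun j => ?_)
  simpa using congrFun h0 j

/-- If `n + deg P` were at most `N + 1`, the preceding lower bound would be violated by `H ^ (-w) *
H ^ N → 0`. Thus good approximation forces `P` to have large degree. -/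
theorem eventually_lt_add_natDegree {n N : ℕ} (hn : 1 ≤ n) (ξ : ℝ) {w : ℝ} (hw : (N : ℝ) < w) :
    ∀ᶠ H : ℝ in atTop, ∀ P Q : Polynomial ℤ, Irreducible P → ¬ P ∣ Q → Q.natDegree ≤ n →
      (∀ i, |(P.coeff i : ℝ)| ≤ H) → (∀ i, |(Q.coeff i : ℝ)| ≤ H) →
      |Polynomial.aeval ξ P| ≤ H ^ (-w) → |Polynomial.aeval ξ Q| ≤ H ^ (-w) →
      N + 1 < n + P.natDegree := by
  set K : ℝ := (N + 1).factorial * 2 ^ (N + 1) * (1 + |ξ|) ^ N with hK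
  filter_upwards [eventually_mul_rpow_le_rpow (2 * K) (neg_lt_neg hw), eventually_ge_atTop 1]
    with H hH hH1 P Q hP hPQ hQ hPc hQc hPv hQv
  by_contra! hcon
  obtain ⟨N', hN'⟩ : ∃ N', n + P.natDegree = N' + 1 := ⟨n + P.natDegree - 1, by omega⟩
  have hH0 : 0 < H := by linarith
  have hNN : N' ≤ N := by omega
  have hξ1 : 1 ≤ 1 + |ξ| := by linarith [abs_nonneg ξ]
  have h1 := one_le_of_irreducible_of_not_dvd hP hPQ hN' hQ (Real.rpow_pos_of_pos hH0 _) hH0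
    hPc hQc hPv hQv
  have h2 : ((N' + 1).factorial : ℝ) * 2 ^ (N' + 1) * (1 + |ξ|) ^ N' ≤ K := by
    rw [hK]
    gcongr
    · norm_num
  have h3 : H ^ N' ≤ H ^ N := pow_le_pow_right₀ hH1 hNN
  have h4 : 0 < H ^ (-w) := Real.rpow_pos_of_pos hH0 _
  have h5 : 1 ≤ K * H ^ (-w) * H ^ N := h1.trans (by gcongr)
  have h6 : H ^ (-(N : ℝ)) * H ^ N = 1 := by
    rw [Real.rpow_neg hH0.le, Real.rpow_natCast]
    exact inv_mul_cancel₀ (by positivity)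
  have h7 : 2 * (K * H ^ (-w) * H ^ N) ≤ 1 := by
    rw [← h6, ← mul_assoc, ← mul_assoc]
    exact mul_le_mul_of_nonneg_right hH (by positivity)
  linarith

/-- A larger `w` would allow `N = 2n - 1` in the degree estimate, giving `deg P > n`. -/
theorem le_of_eventually_linearFormSolvable {ξ : ℝ} (hξ : Transcendental ℚ ξ) {n : ℕ}
    (hn : 1 ≤ n) {w : ℝ} (hsol : ∀ᶠ X : ℝ in atTop, LinearFormSolvable (veronesePoint n ξ) w X) :
    w ≤ 2 * n - 1 := by
  by_contra! hcon
  obtain ⟨w', hw1, hw2⟩ := exists_between hcon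
  have hn' : (1 : ℝ) ≤ n := by exact_mod_cast hn
  obtain ⟨T, hT⟩ := eventually_atTop.mp (eventually_lt_add_natDegree (N := 2 * n - 1) hn ξ (w := w')
    (by rw [Nat.cast_sub (by omega)]; push_cast; exact hw1))
  obtain ⟨P, Q, H, hTH, hP, hPQ, hPd, hQd, hPc, hQc, hPv, hQv⟩ :=
    exists_irreducible_and_not_dvd hξ (by linarith) hw2 hsol T
  have := hT H hTH P Q hP hPQ hQd hPc hQc hPv hQv
  omega

/-! ### From polynomials in degree `n` to simultaneous approximation in dimension `N`. -/

theorem simultaneousSolvable_of_int_vector {N : ℕ} {ξ l X A B : ℝ} {z : Fin (N + 1) → ℤ}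
    (hz : z ≠ 0) (h0 : |(z 0 : ℝ)| ≤ A)
    (h : ∀ j : Fin N, |ξ ^ ((j : ℕ) + 1) * (z 0 : ℝ) - z j.succ| ≤ B) (hB : B < 1)
    (hA : A ≤ X) (hBX : B ≤ X ^ (-l)) : SimultaneousSolvable (veronesePoint N ξ) l X := by
  refine ⟨z 0, fun j => z j.succ, ?_, h0.trans hA, fun j => (h j).trans hBX⟩
  -- If `z 0 = 0`, the other coordinates are integers of absolute value less than `1`, so `z = 0`.
  have hz0 : z 0 ≠ 0 := by
    intro hz0
    refine hz (funext fun j => ?_)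
    refine Fin.cases hz0 (fun j => ?_) j
    have := (h j).trans_lt hB
    rw [hz0, Int.cast_zero, mul_zero, zero_sub, abs_neg] at this
    exact Int.abs_lt_one_iff.mp (by exact_mod_cast this)
  exact_mod_cast Int.one_le_abs hz0

theorem frequently_simultaneousSolvable_of_lt_inv {N : ℕ} (ξ : ℝ) {l : ℝ} (hl : 0 < l)
    (hlN : l * N < 1) : ∃ᶠ X : ℝ in atTop, SimultaneousSolvable (veronesePoint N ξ) l X := by
  refine Eventually.frequently ?_
  have hN : (0 : ℝ) < N + 1 := by positivity
  filter_upwards [eventually_mul_rpow_le_rpow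
    (2 * ((N + 1).factorial * (N + 1) ^ (N + 1))) (a := l * N) (b := 1) hlN, eventually_gt_atTop 1]
    with X hX hX1
  have hX0 : 0 < X := by linarith
  -- With no orthogonality condition (`d = 0`, `0 ^ 0 = 1`), this is Dirichlet's theorem up to
  -- constants, absorbed by `l * N < 1`.
  obtain ⟨z, hz, -, h0, hj⟩ := exists_int_orthogonal_coeff (N := N) (d := 0) (ξ := ξ) (E := 0)
    (Nat.zero_le _) (div_pos hX0 hN) (div_pos (Real.rpow_pos_of_pos hX0 (-l)) hN)
    (fun _ => 0) (by simp) (by simp) (by simp) (by simp) (by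
      rw [pow_zero, mul_one, div_pow, div_mul_div_comm, ← pow_succ', lt_div_iff₀ (by positivity),
        ← Real.rpow_natCast (X ^ (-l)), ← Real.rpow_mul hX0.le, neg_mul, Real.rpow_neg hX0.le,
        ← div_eq_mul_inv, lt_div_iff₀ (Real.rpow_pos_of_pos hX0 _)]
      rw [Real.rpow_one] at hX
      have : 0 < ((N + 1).factorial : ℝ) * (N + 1) ^ (N + 1) * X ^ (l * N) := by positivity
      linarith)
  refine simultaneousSolvable_of_int_vector hz h0 hj ?_ ?_ ?_ <;> rw [mul_div_cancel₀ _ hN.ne']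
  exact Real.rpow_lt_one_of_one_lt_of_neg hX1 (by linarith)

theorem eventually_linearFormSolvable_of_lt {n : ℕ} (ξ : ℝ) {w : ℝ} (hw : w < n) :
    ∀ᶠ X : ℝ in atTop, LinearFormSolvable (veronesePoint n ξ) w X := by
  filter_upwards [eventually_mul_rpow_le_rpow 2 hw, eventually_gt_atTop 0] with X hX hX0
  set A : Matrix (Fin (n + 1)) (Fin (n + 1)) ℝ :=
    Matrix.of (Fin.cons (fun j => ξ ^ (j : ℕ)) fun i => Pi.single i.succ 1) with hA
  have hdet : A.det = 1 := by
    rw [Matrix.det_of_isUpperTriangular]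
    · rw [Fin.prod_univ_succ]; simp [hA]
    · intro i j hij
      have hij : j < i := hij
      obtain ⟨i, rfl⟩ := Fin.exists_succ_eq.mpr (((Fin.zero_le j).trans_lt hij).ne')
      simp [hA, hij.ne]
  obtain ⟨z, hz, hb⟩ := exists_int_ne_zero_abs_mulVec_le A (by rw [hdet]; exact one_ne_zero)
    (Fin.cons (X ^ (-w)) fun _ => X)
    (fun i => Fin.cases (by simpa using Real.rpow_pos_of_pos hX0 _) (fun _ => by simpa) i) (by
      rw [hdet, abs_one, Fin.prod_univ_succ]
      simp only [Fin.cons_zero, Fin.cons_succ, Finset.prod_const, Finset.card_univ,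
        Fintype.card_fin]
      have hpos := Real.rpow_pos_of_pos hX0 w
      rw [Real.rpow_neg hX0.le, ← div_eq_inv_mul, lt_div_iff₀ hpos]
      rw [Real.rpow_natCast] at hX
      linarith)
  refine ⟨z 0, fun j => z j.succ, ?_, fun j => ?_, ?_⟩
  · rintro ⟨h0, hs⟩
    exact hz (funext fun j => Fin.cases h0 (fun j => congrFun hs j) j)
  · simpa [hA, Matrix.mulVec, dotProduct, Pi.single_apply] using hb j.succ
  · simpa [hA, Matrix.mulVec, dotProduct, Fin.sum_univ_succ, veronesePoint] using hb 0

/-- The lattice orthogonal to the shifts has rank `r`, and the excess `w - N` is shared among its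
`r` dimensions; this is `e`. The conclusion amounts to `λ_N ≥ (1 + e) / (w - e)`, the ratio of the
exponents of error and size. -/
theorem frequently_simultaneousSolvable_of_linearFormSolvable {ξ : ℝ} (hξ : Transcendental ℚ ξ)
    {n N r : ℕ} (hnN : n ≤ N) (hr : N + 1 + r = 2 * n) (hr0 : 1 ≤ r) {w e l : ℝ}
    (hw : (N : ℝ) < w) (he : e * r = w - N) (hl : l * (w - e) < 1 + e)
    (hsol : ∀ᶠ X : ℝ in atTop, LinearFormSolvable (veronesePoint n ξ) w X) :
    ∃ᶠ X : ℝ in atTop, SimultaneousSolvable (veronesePoint N ξ) l X := by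
  have hr1 : (1 : ℝ) ≤ r := by exact_mod_cast hr0
  have hN0 : (0 : ℝ) ≤ N := Nat.cast_nonneg N
  have he0 : 0 < e := by
    by_contra! h
    nlinarith
  -- Lowering `e` and then `w` a little makes the exponent inequalities below strict, so that
  -- constants are absorbed for large `H`.
  obtain ⟨e', hle', he'0, he'⟩ : ∃ e', l * (w - e') < 1 + e' ∧ 0 < e' ∧ e' < e := by
    have hcont : Continuous fun x : ℝ => 1 + x - l * (w - x) := by fun_prop
    have hev : ∀ᶠ x in 𝓝[<] e, 0 < 1 + x - l * (w - x) :=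
      nhdsWithin_le_nhds (hcont.continuousAt.eventually_const_lt (by linarith))
    obtain ⟨x, h1, h2, h3⟩ := (hev.and ((eventually_mem_nhdsWithin (s := Set.Iio e)).and
      (nhdsWithin_le_nhds (eventually_gt_nhds he0)))).exists
    exact ⟨x, by linarith, h3, h2⟩
  obtain ⟨w', hw'1, hw'2⟩ : ∃ w', N + r * e' < w' ∧ w' < w := exists_between (by nlinarith)
  have hNw' : (N : ℝ) < w' := by nlinarith
  have hwe' : 0 < w - e' := by nlinarith
  set k := N + 1 - n with hk
  have hkn : n + k = N + 1 := by omega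
  set D : ℝ := (1 + |ξ|) ^ N with hD
  have hD1 : 1 ≤ D := one_le_pow₀ (by linarith [abs_nonneg ξ])
  rw [frequently_atTop]
  intro T
  -- The volume condition in exponents of `H`; since `2k = N + 1 - r`, it reads `N + r * e' < w'`.
  have hexp : -e' * (k + k : ℕ) < w' - e' + (-1 - e') * N := by
    have h1 : ((k + k : ℕ) : ℝ) = N + 1 - r := by
      have : k + k + r = N + 1 := by omega
      rw [eq_sub_iff_add_eq]
      exact_mod_cast this
    rw [h1]
    nlinarith
  obtain ⟨T₀, hT₀⟩ := eventually_atTop.mp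
    ((eventually_lt_add_natDegree (n := n) (N := N) (by omega) ξ hNw').and
      ((eventually_mul_rpow_le_rpow (2 * ((N + 1).factorial * (2 * D) ^ (k + k))) hexp).and
      ((eventually_mul_rpow_le_rpow (N + 1) (a := w' - e') (b := w - e') (by linarith)).and
      ((eventually_mul_rpow_le_rpow (N + 1) (a := -1 - e') (b := (w - e') * (-l))
        (by linarith)).and
      ((eventually_mul_rpow_le_rpow (2 * (N + 1)) (a := -1 - e') (b := 0) (by linarith)).and
      (((tendsto_rpow_atTop hwe').eventually_ge_atTop T).and (eventually_ge_atTop 1)))))))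
  obtain ⟨P, Q, H, hTH, hP, hPQ, hPd, hQd, hPc, hQc, hPv, hQv⟩ :=
    exists_irreducible_and_not_dvd hξ (hN0.trans_lt hNw') hw'2 hsol T₀
  obtain ⟨h1, h2, h3, h4, h5, h6, h7⟩ := hT₀ H hTH
  have hH0 : 0 < H := by linarith
  have hPdeg := h1 P Q hP hPQ hQd hPc hQc hPv hQv
  have hdeg : ∀ i < k + k, (shiftFamily P Q k i).natDegree ≤ N := fun i hi =>
    natDegree_shiftFamily_le (l := k) (by omega) (by omega) hi
  -- These choices balance the two constraints: value times `X` and height times `Y` are both at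
  -- most `D * H ^ (-e')`.
  obtain ⟨z, hz, -, hz0, hzj⟩ := exists_int_orthogonal_coeff (ξ := ξ) (X := H ^ (w' - e'))
    (Y := H ^ (-1 - e')) (E := D * H ^ (-e')) (by omega : k + k ≤ N + 1)
    (Real.rpow_pos_of_pos hH0 _) (Real.rpow_pos_of_pos hH0 _) (shiftFamily P Q k) hdeg
    (linearIndepOn_coeff_shiftFamily hP hPQ (by omega) (by omega) hdeg)
    (fun i hi => by
      refine (mul_le_mul_of_nonneg_right (abs_aeval_shiftFamily_le
        hPv hQv k (N := N) (by omega))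
        (Real.rpow_nonneg hH0.le _)).trans (le_of_eq ?_)
      rw [mul_assoc, ← Real.rpow_add hH0]
      congr 2; ring)
    (fun i _ j => by
      have hHe : H * H ^ (-1 - e') = H ^ (-e') := by
        nth_rewrite 1 [← Real.rpow_one H]
        rw [← Real.rpow_add hH0]
        congr 1; ring
      refine (mul_le_mul_of_nonneg_right (abs_coeff_shiftFamily_le hH0.le hPc hQc k i j)
        (Real.rpow_nonneg hH0.le _)).trans ?_
      rw [hHe]
      exact le_mul_of_one_le_left (Real.rpow_nonneg hH0.le _) hD1)
    (by
      rw [← mul_assoc 2 D, mul_pow, ← Real.rpow_natCast (H ^ (-e')), ← Real.rpow_mul hH0.le,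
        ← Real.rpow_natCast (H ^ (-1 - e')), ← Real.rpow_mul hH0.le, ← Real.rpow_add hH0,
        ← mul_assoc]
      refine lt_of_lt_of_le ?_ h2
      have : 0 < ((N + 1).factorial : ℝ) * (2 * D) ^ (k + k) * H ^ (-e' * (k + k : ℕ)) := by
        positivity
      linarith)
  refine ⟨H ^ (w - e'), h6, simultaneousSolvable_of_int_vector hz hz0 hzj ?_ h3 ?_⟩
  · rw [Real.rpow_zero] at h5
    linarith
  · rwa [← Real.rpow_mul hH0.le]

/-! ### Translation to the extended real exponents. -/

theorem coe_le_lambdaExponent {N : ℕ} {ξ l : ℝ}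
    (h : ∃ᶠ X : ℝ in atTop, SimultaneousSolvable (veronesePoint N ξ) l X) :
    (l : EReal) ≤ lambdaExponent N ξ :=
  le_sSup ⟨l, rfl, h⟩

theorem coe_le_wHatExponent {n : ℕ} {ξ w : ℝ}
    (h : ∀ᶠ X : ℝ in atTop, LinearFormSolvable (veronesePoint n ξ) w X) :
    (w : EReal) ≤ wHatExponent n ξ :=
  le_sSup ⟨w, rfl, h⟩

theorem natCast_le_wHatExponent (n : ℕ) (ξ : ℝ) : ((n : ℝ) : EReal) ≤ wHatExponent n ξ :=
  EReal.ge_of_forall_gt_iff_ge.mp fun _ hw =>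
    coe_le_wHatExponent (eventually_linearFormSolvable_of_lt ξ (EReal.coe_lt_coe_iff.mp hw))

theorem wHatExponent_le {ξ : ℝ} (hξ : Transcendental ℚ ξ) {n : ℕ} (hn : 1 ≤ n) :
    wHatExponent n ξ ≤ ((2 * n - 1 : ℝ) : EReal) := by
  refine sSup_le ?_
  rintro _ ⟨w, rfl, hw⟩
  exact EReal.coe_le_coe_iff.mpr (le_of_eventually_linearFormSolvable hξ hn hw)

theorem LinearFormSolvable.mono {N : ℕ} {ξ : Fin N → ℝ} {w w' X : ℝ} (hX : 1 ≤ X) (hw : w' ≤ w)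
    (h : LinearFormSolvable ξ w X) : LinearFormSolvable ξ w' X := by
  obtain ⟨a, x, h1, h2, h3⟩ := h
  exact ⟨a, x, h1, h2, h3.trans (Real.rpow_le_rpow_of_exponent_le hX (by linarith))⟩

theorem eventually_linearFormSolvable_of_lt_wHatExponent {n : ℕ} {ξ w : ℝ}
    (h : (w : EReal) < wHatExponent n ξ) :
    ∀ᶠ X : ℝ in atTop, LinearFormSolvable (veronesePoint n ξ) w X := by
  obtain ⟨_, ⟨w₁, rfl, hw₁⟩, hlt⟩ := lt_sSup_iff.mp h
  filter_upwards [hw₁, eventually_ge_atTop 1] with X hX hX1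
  exact hX.mono hX1 (EReal.coe_lt_coe_iff.mp hlt).le

theorem one_le_wHatExponent_div {n : ℕ} (hn : 1 ≤ n) (ξ : ℝ) :
    ((1 : ℝ) : EReal) ≤ wHatExponent n ξ / (n : EReal) := by
  have hn0 : (0 : EReal) < n := by exact_mod_cast hn
  rw [EReal.le_div_iff_mul_le hn0 (EReal.natCast_ne_top n), EReal.coe_one, one_mul]
  exact_mod_cast natCast_le_wHatExponent n ξ

theorem wHatExponent_div_le_two {ξ : ℝ} (hξ : Transcendental ℚ ξ) {n : ℕ} (hn : 1 ≤ n) :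
    wHatExponent n ξ / (n : EReal) ≤ ((2 : ℝ) : EReal) := by
  have hn0 : (0 : EReal) < n := by exact_mod_cast hn
  rw [EReal.div_le_iff_le_mul hn0 (EReal.natCast_ne_top n)]
  refine (wHatExponent_le hξ hn).trans ?_
  rw [← EReal.coe_coe_eq_natCast, ← EReal.coe_mul, EReal.coe_le_coe_iff]
  linarith

theorem eventually_linearFormSolvable_of_lt_wHatExponent_div {n : ℕ} (hn : 1 ≤ n) {ξ W : ℝ}
    (h : (W : EReal) < wHatExponent n ξ / (n : EReal)) :
    ∀ᶠ X : ℝ in atTop, LinearFormSolvable (veronesePoint n ξ) (W * n) X := by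
  have hn0 : (0 : EReal) < n := by exact_mod_cast hn
  refine eventually_linearFormSolvable_of_lt_wHatExponent ?_
  rw [EReal.lt_div_iff hn0 (EReal.natCast_ne_top n)] at h
  rwa [EReal.coe_mul, EReal.coe_coe_eq_natCast]

theorem coe_le_natCast_mul_lambdaExponent {N : ℕ} (hN : 1 ≤ N) {ξ c : ℝ}
    (h : ∃ᶠ X : ℝ in atTop, SimultaneousSolvable (veronesePoint N ξ) (c / N) X) :
    (c : EReal) ≤ (N : EReal) * lambdaExponent N ξ := by
  have hN0 : (N : ℝ) ≠ 0 := by positivity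
  have h1 : (c : EReal) = (N : EReal) * ((c / N : ℝ) : EReal) := by
    rw [← EReal.coe_coe_eq_natCast, ← EReal.coe_mul, mul_div_cancel₀ _ hN0]
  rw [h1]
  exact mul_le_mul_of_nonneg_left (coe_le_lambdaExponent h) (Nat.cast_nonneg' N)

theorem one_le_natCast_mul_lambdaExponent {N : ℕ} (hN : 1 ≤ N) (ξ : ℝ) :
    ((1 : ℝ) : EReal) ≤ (N : EReal) * lambdaExponent N ξ := by
  have hN0 : (0 : ℝ) < N := by exact_mod_cast hN
  refine EReal.ge_of_forall_gt_iff_ge.mp fun c hc => ?_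
  have hc1 : c < 1 := EReal.coe_lt_coe_iff.mp hc
  have hmax : max c (1 / 2) < 1 := max_lt hc1 (by norm_num)
  have hpos : 0 < max c (1 / 2) := lt_max_of_lt_right (by norm_num)
  refine (EReal.coe_le_coe_iff.mpr (le_max_left c (1 / 2))).trans
    (coe_le_natCast_mul_lambdaExponent hN
      (frequently_simultaneousSolvable_of_lt_inv ξ (div_pos hpos hN0) ?_))
  rwa [div_mul_cancel₀ _ hN0.ne']

/-! ### Asymptotics along `N ∼ t n` and optimization of `t`. -/

/-- Here `n = u k` and `N = v k`. Two sequences are kept free because the limsup argument prescribes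
`n` and the liminf argument prescribes `N`. -/
theorem eventually_coe_le_natCast_mul_lambdaExponent {ξ : ℝ} (hξ : Transcendental ℚ ξ)
    {t W c : ℝ} (ht1 : 1 < t) (htW : t < W) (ht2 : t < 2)
    (hc : c * W < t * (1 + (W - t) / (2 - t))) {u v : ℕ → ℕ} (hu : Tendsto u atTop atTop)
    (huv : Tendsto (fun k => (v k : ℝ) / u k) atTop (𝓝 t)) :
    ∀ᶠ k in atTop,
      (∀ᶠ X : ℝ in atTop, LinearFormSolvable (veronesePoint (u k) ξ) (W * u k) X) →
        (c : EReal) ≤ (v k : EReal) * lambdaExponent (v k) ξ := by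
  have hu' : Tendsto (fun k => (u k : ℝ)) atTop atTop := tendsto_natCast_atTop_atTop.comp hu
  have hinv : Tendsto (fun k => (u k : ℝ)⁻¹) atTop (𝓝 0) := tendsto_inv_atTop_zero.comp hu'
  -- This is `r / n` for the rank `r = 2n - N - 1`, and `e` below is `(W n - N) / r`.
  set ρ : ℕ → ℝ := fun k => 2 - (v k : ℝ) / u k - (u k : ℝ)⁻¹ with hρdef
  have hρ : Tendsto ρ atTop (𝓝 (2 - t)) := by
    simpa using (huv.const_sub 2).sub hinv
  set e : ℕ → ℝ := fun k => (W - (v k : ℝ) / u k) / ρ k with hedef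
  have he : Tendsto e atTop (𝓝 ((W - t) / (2 - t))) :=
    (huv.const_sub W).div hρ (by linarith)
  have hcond : Tendsto (fun k => (v k : ℝ) / u k * (1 + e k) - c * (W - e k * (u k : ℝ)⁻¹)) atTop
      (𝓝 (t * (1 + (W - t) / (2 - t)) - c * (W - (W - t) / (2 - t) * 0))) :=
    (huv.mul (he.const_add 1)).sub (((he.mul hinv).const_sub W).const_mul c)
  filter_upwards [hu.eventually_ge_atTop 1, huv.eventually_const_lt ht1,
    huv.eventually_lt_const htW, hρ.eventually_const_lt (by linarith : (0 : ℝ) < 2 - t),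
    hcond.eventually_const_lt (by rw [mul_zero, sub_zero]; linarith : (0 : ℝ) < _)]
    with k hk1 hk2 hk3 hk4 hk5 hsol
  have hu0 : (0 : ℝ) < u k := by exact_mod_cast hk1
  have hnN : u k < v k := by
    rw [lt_div_iff₀ hu0, one_mul] at hk2
    exact_mod_cast hk2
  have hNw : (v k : ℝ) < W * u k := by rwa [div_lt_iff₀ hu0] at hk3
  have hρu : ρ k * u k = 2 * u k - v k - 1 := by
    rw [hρdef]
    field_simp
  have hr : v k + 1 < 2 * u k := by
    have : (0 : ℝ) < ρ k * u k := mul_pos hk4 hu0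
    rw [hρu] at this
    have : ((v k + 1 : ℕ) : ℝ) < ((2 * u k : ℕ) : ℝ) := by push_cast; linarith
    exact_mod_cast this
  obtain ⟨r, hr'⟩ := Nat.exists_eq_add_of_lt hr
  have hrcast : ((r + 1 : ℕ) : ℝ) = ρ k * u k := by
    rw [hρu]
    have : ((2 * u k : ℕ) : ℝ) = ((v k + 1 + r + 1 : ℕ) : ℝ) := by rw [hr']
    push_cast at this ⊢
    linarith
  have hv0 : (0 : ℝ) < v k := by
    have : 0 < v k := by omega
    exact_mod_cast this
  refine coe_le_natCast_mul_lambdaExponent (by omega)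
    (frequently_simultaneousSolvable_of_linearFormSolvable hξ hnN.le (r := r + 1) (by omega)
      (by omega) hNw (e := e k) ?_ ?_ hsol)
  · rw [hrcast, hedef]
    field_simp
  · rw [div_mul_eq_mul_div, div_lt_iff₀ hv0]
    have h1 : c * (W * u k - e k) = (c * (W - e k * (u k : ℝ)⁻¹)) * u k := by field_simp
    have h2 : (1 + e k) * v k = ((v k : ℝ) / u k * (1 + e k)) * u k := by field_simp
    rw [h1, h2]
    exact mul_lt_mul_of_pos_right (by linarith) hu0

theorem asymptoticBound_one : asymptoticBound 1 = 1 := by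
  norm_num [asymptoticBound]

theorem exists_lt_of_lt_asymptoticBound {W c : ℝ} (hW1 : 1 < W) (hW2 : W ≤ 2)
    (hc : c < asymptoticBound W) :
    ∃ t W', 1 < t ∧ t < W' ∧ t < 2 ∧ W' < W ∧ c * W' < t * (1 + (W' - t) / (2 - t)) := by
  suffices h : ∃ t, 1 < t ∧ t < W ∧ t < 2 ∧ c * W < t * (1 + (W - t) / (2 - t)) by
    obtain ⟨t, h1, h2, h3, h4⟩ := h
    have hcont : Continuous fun x : ℝ => t * (1 + (x - t) / (2 - t)) - c * x := by fun_prop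
    have hev : ∀ᶠ x in 𝓝[<] W, 0 < t * (1 + (x - t) / (2 - t)) - c * x :=
      nhdsWithin_le_nhds (hcont.continuousAt.eventually_const_lt (by linarith))
    obtain ⟨x, hx1, hx2, hx3⟩ := (hev.and ((eventually_mem_nhdsWithin (s := Set.Iio W)).and
      (nhdsWithin_le_nhds (eventually_gt_nhds h2)))).exists
    exact ⟨t, x, h1, hx3, h3, hx2, by linarith⟩
  rcases hW2.eq_or_lt with rfl | hW2
  · rw [asymptoticBound, if_pos rfl] at hc
    obtain ⟨t, ht1, ht2⟩ := exists_between (max_lt hc one_lt_two)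
    have hct := (le_max_left _ _).trans_lt ht1
    -- At `W = 2` the limiting lower bound for `N λ_N` is `t` itself, so the value `2` is only
    -- approached as `t → 2`.
    refine ⟨t, (le_max_right _ _).trans_lt ht1, ht2, ht2, ?_⟩
    rw [div_self (by linarith)]
    linarith
  · rw [asymptoticBound, if_neg hW2.ne] at hc
    set s := √(2 - W) with hs
    have hs0 : 0 < s := Real.sqrt_pos.mpr (by linarith)
    have hs2 : s * s = 2 - W := Real.mul_self_sqrt (by linarith)
    have hs1 : s < 1 := by nlinarith
    -- Writing `t = 2 - x`, the quantity to maximize is `4 + s ^ 2 - 2 * (x + s ^ 2 / x)`, largest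
    -- at `x = s`.
    refine ⟨2 - s, by linarith, by nlinarith, by linarith, ?_⟩
    rw [lt_div_iff₀ (by positivity)] at hc
    have h1 : (2 - s) * (1 + (W - (2 - s)) / (2 - (2 - s))) = (2 - s) * (W + 2 * s - 2) / s := by
      rw [sub_sub_cancel]
      field_simp
      ring
    rw [h1, lt_div_iff₀ hs0]
    linarith

theorem tendsto_natFloor_mul_div {t : ℝ} (ht : 0 ≤ t) :
    Tendsto (fun n : ℕ => (⌊t * n⌋₊ : ℝ) / n) atTop (𝓝 t) :=
  (tendsto_nat_floor_mul_div_atTop ht).comp tendsto_natCast_atTop_atTop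

theorem tendsto_div_natCeil_div {t : ℝ} (ht : 0 < t) :
    Tendsto (fun n : ℕ => (n : ℝ) / ⌈t⁻¹ * n⌉₊) atTop (𝓝 t) := by
  have h := ((tendsto_nat_ceil_mul_div_atTop (R := ℝ) (inv_nonneg.mpr ht.le)).comp
    tendsto_natCast_atTop_atTop).inv₀ (inv_ne_zero ht.ne')
  simpa [Function.comp_def] using h

theorem asymptoticBound_le_limsup {ξ : ℝ} (hξ : Transcendental ℚ ξ) {W : ℝ} (hW1 : 1 ≤ W)
    (hW2 : W ≤ 2) (hW : limsup (fun n : ℕ => wHatExponent n ξ / (n : EReal)) atTop = (W : EReal)) :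
    (asymptoticBound W : EReal) ≤
      limsup (fun n : ℕ => (n : EReal) * lambdaExponent n ξ) atTop := by
  -- At `W = 1` the optimal `t` is `1`, outside the range `1 < t < W`; Dirichlet's bound `N λ_N ≥ 1`
  -- suffices there.
  rcases hW1.eq_or_lt with rfl | hW1
  · rw [asymptoticBound_one]
    refine le_limsup_of_frequently_le (Eventually.frequently ?_)
    filter_upwards [eventually_ge_atTop 1] with n hn using one_le_natCast_mul_lambdaExponent hn ξ
  · refine EReal.ge_of_forall_gt_iff_ge.mp fun c hc => ?_
    obtain ⟨t, W', ht1, htW, ht2, hWW, hcW⟩ :=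
      exists_lt_of_lt_asymptoticBound hW1 hW2 (EReal.coe_lt_coe_iff.mp hc)
    have hfr : ∃ᶠ n : ℕ in atTop, (W' : EReal) < wHatExponent n ξ / (n : EReal) :=
      frequently_lt_of_lt_limsup (by isBoundedDefault)
        (by rw [hW]; exact EReal.coe_lt_coe_iff.mpr hWW)
    -- Infinitely many good `n` are pushed forward to the infinitely many `N = ⌊t n⌋`.
    have hev := eventually_coe_le_natCast_mul_lambdaExponent hξ ht1 htW ht2 hcW tendsto_id
      (tendsto_natFloor_mul_div (by linarith : 0 ≤ t))
    have hfr' := (hfr.and_eventually (hev.and (eventually_ge_atTop 1))).mono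
      fun n hn => hn.2.1 (eventually_linearFormSolvable_of_lt_wHatExponent_div hn.2.2 hn.1)
    have htend : Tendsto (fun n : ℕ => ⌊t * n⌋₊) atTop atTop :=
      tendsto_nat_floor_atTop.comp (tendsto_natCast_atTop_atTop.const_mul_atTop (by linarith))
    exact le_limsup_of_frequently_le
      (htend.frequently (p := fun N : ℕ => (c : EReal) ≤ (N : EReal) * lambdaExponent N ξ) hfr')

theorem asymptoticBound_le_liminf {ξ : ℝ} (hξ : Transcendental ℚ ξ) {W : ℝ} (hW1 : 1 ≤ W)
    (hW2 : W ≤ 2) (hW : liminf (fun n : ℕ => wHatExponent n ξ / (n : EReal)) atTop = (W : EReal)) :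
    (asymptoticBound W : EReal) ≤
      liminf (fun n : ℕ => (n : EReal) * lambdaExponent n ξ) atTop := by
  rcases hW1.eq_or_lt with rfl | hW1
  · rw [asymptoticBound_one]
    refine le_liminf_of_le (by isBoundedDefault) ?_
    filter_upwards [eventually_ge_atTop 1] with n hn using one_le_natCast_mul_lambdaExponent hn ξ
  · refine EReal.ge_of_forall_gt_iff_ge.mp fun c hc => ?_
    obtain ⟨t, W', ht1, htW, ht2, hWW, hcW⟩ :=
      exists_lt_of_lt_asymptoticBound hW1 hW2 (EReal.coe_lt_coe_iff.mp hc)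
    have hWev : ∀ᶠ n : ℕ in atTop, (W' : EReal) < wHatExponent n ξ / (n : EReal) :=
      eventually_lt_of_lt_liminf (by rw [hW]; exact EReal.coe_lt_coe_iff.mpr hWW)
    have ht0 : 0 < t := by linarith
    -- Every large `N` must be reached, so `N` is given and the polynomial degree is taken to be `⌈N
    -- / t⌉`.
    have htend : Tendsto (fun n : ℕ => ⌈t⁻¹ * n⌉₊) atTop atTop :=
      tendsto_nat_ceil_atTop.comp
        (tendsto_natCast_atTop_atTop.const_mul_atTop (inv_pos.mpr ht0))
    refine le_liminf_of_le (by isBoundedDefault) ?_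
    filter_upwards [htend.eventually hWev, htend.eventually_ge_atTop 1,
      eventually_coe_le_natCast_mul_lambdaExponent hξ ht1 htW ht2 hcW htend
        (v := id) (tendsto_div_natCeil_div ht0)] with n h1 h2 h3
    exact h3 (eventually_linearFormSolvable_of_lt_wHatExponent_div h2 h1)

theorem EReal.exists_coe_eq_of_mem_Icc {x : EReal} {a b : ℝ} (ha : (a : EReal) ≤ x)
    (hb : x ≤ (b : EReal)) : ∃ y : ℝ, x = (y : EReal) ∧ a ≤ y ∧ y ≤ b := by
  induction x using EReal.rec with
  | bot => exact absurd ha (by simp)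
  | top => exact absurd hb (by simp)
  | coe y => exact ⟨y, rfl, EReal.coe_le_coe_iff.mp ha, EReal.coe_le_coe_iff.mp hb⟩

theorem mainTheorem6 (ξ : ℝ) (hξ : Transcendental ℚ ξ) :
    (∃ W : ℝ,
      limsup (fun n : ℕ => wHatExponent n ξ / (n : EReal)) atTop = (W : EReal) ∧
      1 ≤ W ∧ W ≤ 2 ∧
      (asymptoticBound W : EReal) ≤
        limsup (fun n : ℕ => (n : EReal) * lambdaExponent n ξ) atTop) ∧
    (∃ W : ℝ,
      liminf (fun n : ℕ => wHatExponent n ξ / (n : EReal)) atTop = (W : EReal) ∧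
      1 ≤ W ∧ W ≤ 2 ∧
      (asymptoticBound W : EReal) ≤
        liminf (fun n : ℕ => (n : EReal) * lambdaExponent n ξ) atTop) := by
  have hlow : ((1 : ℝ) : EReal) ≤
      liminf (fun n : ℕ => wHatExponent n ξ / (n : EReal)) atTop := by
    refine le_liminf_of_le (by isBoundedDefault) ?_
    filter_upwards [eventually_ge_atTop 1] with n hn using one_le_wHatExponent_div hn ξ
  have hupp : limsup (fun n : ℕ => wHatExponent n ξ / (n : EReal)) atTop ≤ ((2 : ℝ) : EReal) := by
    refine limsup_le_of_le (by isBoundedDefault) ?_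
    filter_upwards [eventually_ge_atTop 1] with n hn using wHatExponent_div_le_two hξ hn
  have hle : liminf (fun n : ℕ => wHatExponent n ξ / (n : EReal)) atTop ≤
      limsup (fun n : ℕ => wHatExponent n ξ / (n : EReal)) atTop := liminf_le_limsup
  obtain ⟨W, hW, hW1, hW2⟩ := EReal.exists_coe_eq_of_mem_Icc (hlow.trans hle) hupp
  obtain ⟨V, hV, hV1, hV2⟩ := EReal.exists_coe_eq_of_mem_Icc hlow (hle.trans hupp)
  exact ⟨⟨W, hW, hW1, hW2, asymptoticBound_le_limsup hξ hW1 hW2 hW⟩,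
    ⟨V, hV, hV1, hV2, asymptoticBound_le_liminf hξ hV1 hV2 hV⟩⟩
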